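/- Let $k$ be a field and let $\mathsf E$ be a small $k$-linear category. For objects $x,y$ write $x\preceq y$ if there are $n\ge 1$ and objects $x=z_0,z_1,\dots,z_n=y$ with $\operatorname{Hom}_{\mathsf E}(z_{i-1},z_i)\neq 0$ for all $1\le i\le n$, and write $x\prec y$ if $x\preceq y$ and $y\not\preceq x$. Assume that $\mathsf E$ is left strictly locally finite, that is: 1. $\operatorname{Hom}_{\mathsf E}(x,y)$ is finite-dimensional for all objects $x,y$; 2. the set $\{z : x\preceq z\preceq y\}$ is finite for all objects $x,y$; 3. for every object $y$ there is a finite set of objects $X_y$ such that $x\prec y$ for all $x\in X_y$ and every morphism $f\colon z\to y$ with $z\prec y$ can be written as a finite (possibly empty) sum $f=\sum_{i=1}^n h_ig_i$ with $g_i\colon z\to x_i$, $h_i\colon x_i\to y$ and $x_i\in X_y$. Let $\mathcal C_{\mathsf E}=\bigoplus_{x,y}\mathcal C^{x,y}$, $\mathcal C^{x,y}=\operatorname{Hom}_{\mathsf E}(x,y)^*$, be the coalgebra over $k$ whose counit is the evaluation at $\mathrm{id}_x$ on $\mathcal C^{x,x}$ and zero on $\mathcal C^{x,y}$ for $x\ne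 y$, and whose comultiplication restricted to $\mathcal C^{x,y}$ is the sum over the objects $z$ with $x\preceq z\preceq y$ of the maps $\mathcal C^{x,y}\to\mathcal C^{x,z}\otimes_k\mathcal C^{z,y}$ dual to the composition of morphisms. A left $\mathcal C_{\mathsf E}$-contramodule is a $k$-vector space $\mathfrak P$ with a $k$-linear map $\pi\colon\operatorname{Hom}_k(\mathcal C_{\mathsf E},\mathfrak P)\to\mathfrak P$ satisfying the contraassociativity and contraunitality axioms (where $\operatorname{Hom}_k(\mathcal C_{\mathsf E},\operatorname{Hom}_k(\mathcal C_{\mathsf E},\mathfrak P))\simeq\operatorname{Hom}_k(\mathcal C_{\mathsf E}\otimes_k\mathcal C_{\mathsf E},\mathfrak P)$ takes $F$ to $u\otimes v\mapsto F(v)(u)$); morphisms are the $k$-linear maps commuting with the contraactions. A left $\mathsf E$-module is a covariant $k$-linear functor from $\mathsf E$ to $k$-vector spaces. The contramodule forgetful functor $\Theta_{\mathsf E}\colon\mathcal C_{\mathsf E}\text{-}\mathsf{Contra}\to\mathsf E\text{-}\mathsf{Mod}$ takes $\mathfrak P$ to the module $P$ for which $P(x)\subseteq\mathfrak P$ is the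 image of the idempotent operator $p\mapsto\pi(c\mapsto c_{x,x}(\mathrm{id}_x)\,p)$, where $c_{x,y}\in\mathcal C^{x,y}$ denotes the component of $c\in\mathcal C_{\mathsf E}$, and a morphism $f\colon x\to y$ acts by $p\mapsto\pi(c\mapsto c_{x,y}(f)\,p)$; it takes a contramodule morphism to its restrictions to these subspaces. Then $\Theta_{\mathsf E}$ is fully faithful. -/

import Mathlib

open CategoryTheory
open scoped TensorProduct DirectSum

universe t u v w

noncomputable section

/-! ### Contramodules over a coalgebra -/

/-- A left contramodule over a coalgebra `C` over a field `k`: a vector space `P` with a linear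
map `π : Hom_k(C, P) → P`. A map `F : C → Hom_k(C, P)` corresponds to the map
`u ⊗ v ↦ F v u` from `C ⊗ C` to `P` (the convention that gives left contramodules). -/
structure LeftContramodule (k : Type u) [Field k] (C : Type v) [AddCommGroup C] [Module k C]
    [Coalgebra k C] where
  /-- the underlying vector space -/
  carrier : Type t
  [addCommGroup : AddCommGroup carrier]
  [module : Module k carrier]
  /-- the contraaction -/
  π : (C →ₗ[k] carrier) →ₗ[k] carrier
  contraassoc : ∀ F : C →ₗ[k] C →ₗ[k] carrier,
    π (TensorProduct.lift F.flip ∘ₗ Coalgebra.comul) = π (π ∘ₗ F)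
  contraunit : ∀ p : carrier, π ((Coalgebra.counit : C →ₗ[k] k).smulRight p) = p

namespace LeftContramodule

variable {k : Type u} [Field k] {C : Type v} [AddCommGroup C] [Module k C] [Coalgebra k C]

attribute [instance] LeftContramodule.addCommGroup LeftContramodule.module

/-- A morphism of contramodules: a linear map compatible with the contraactions. -/
@[ext]
structure Hom (P Q : LeftContramodule.{t} k C) where
  /-- the underlying linear map -/
  toLin : P.carrier →ₗ[k] Q.carrier
  map_π : ∀ g : C →ₗ[k] P.carrier, toLin (P.π g) = Q.π (toLin ∘ₗ g)

instance : Category (LeftContramodule.{t} k C) where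
  Hom P Q := Hom P Q
  id P := ⟨LinearMap.id, fun _ => rfl⟩
  comp f g := ⟨g.toLin ∘ₗ f.toLin, fun a => by
    simp only [LinearMap.comp_apply, f.map_π, g.map_π, LinearMap.comp_assoc]⟩

/-- The action on `P` of a linear function `a` on `C`, namely `p ↦ π (c ↦ a c • p)`. -/
def act (P : LeftContramodule.{t} k C) (a : C →ₗ[k] k) : P.carrier →ₗ[k] P.carrier :=
  P.π ∘ₗ LinearMap.smulRightₗ a

lemma act_apply (P : LeftContramodule.{t} k C) (a : C →ₗ[k] k) (p : P.carrier) :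
    P.act a p = P.π (a.smulRight p) := rfl

lemma act_add (P : LeftContramodule.{t} k C) (a b : C →ₗ[k] k) (p : P.carrier) :
    P.act (a + b) p = P.act a p + P.act b p := by
  rw [act_apply, act_apply, act_apply, ← map_add]
  congr 1
  ext c
  simp [add_smul]

lemma act_smul (P : LeftContramodule.{t} k C) (r : k) (a : C →ₗ[k] k) (p : P.carrier) :
    P.act (r • a) p = r • P.act a p := by
  rw [act_apply, act_apply, ← map_smul]
  congr 1
  ext c
  simp [mul_smul]

lemma act_act (P : LeftContramodule.{t} k C) (a b : C →ₗ[k] k) (p : P.carrier) :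
    P.act a (P.act b p) =
      P.act (LinearMap.mul' k k ∘ₗ TensorProduct.map b a ∘ₗ Coalgebra.comul) p := by
  have h := P.contraassoc (a.smulRight (b.smulRight p))
  have h1 : P.π ∘ₗ (a.smulRight (b.smulRight p)) = a.smulRight (P.act b p) := by
    ext c
    simp [act_apply]
  have h2 : TensorProduct.lift (a.smulRight (b.smulRight p)).flip
      = (LinearMap.mul' k k ∘ₗ TensorProduct.map b a).smulRight p := by
    apply TensorProduct.ext'
    intro x y
    simp [smul_smul, mul_comm]
  rw [h1, h2] at h
  rw [act_apply, ← h, act_apply]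
  rfl

lemma Hom.map_act {P Q : LeftContramodule.{t} k C} (f : Hom P Q) (a : C →ₗ[k] k)
    (p : P.carrier) : f.toLin (P.act a p) = Q.act a (f.toLin p) := by
  rw [act_apply, act_apply, f.map_π]
  congr 1
  ext c
  simp

end LeftContramodule

/-! ### Linear categories -/

/-- `x ⪯ y`: there is a chain of `n ≥ 1` nonzero morphisms
`x = z₀ ⟶ z₁ ⟶ ⋯ ⟶ zₙ = y` (whose composition may vanish). -/
def HomLE {E : Type v} [Category.{w} E] [Preadditive E] (x y : E) : Prop :=
  Relation.TransGen (fun a b : E => ∃ f : a ⟶ b, f ≠ 0) x y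

/-- `x ≺ y`: `x ⪯ y` and not `y ⪯ x`. -/
def HomLT {E : Type v} [Category.{w} E] [Preadditive E] (x y : E) : Prop :=
  HomLE x y ∧ ¬ HomLE y x

/-- Local finiteness of a `k`-linear category. -/
class LocallyFiniteCat (k : Type u) [Field k] (E : Type v) [Category.{w} E] [Preadditive E]
    [CategoryTheory.Linear k E] : Prop where
  finite_hom : ∀ x y : E, FiniteDimensional k (x ⟶ y)
  finite_interval : ∀ x y : E, {z : E | HomLE x z ∧ HomLE z y}.Finite

/-- Left strict local finiteness of a `k`-linear category. -/
class LeftStrictlyLocallyFiniteCat (k : Type u) [Field k] (E : Type v) [Category.{w} E]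
    [Preadditive E] [CategoryTheory.Linear k E] : Prop extends LocallyFiniteCat k E where
  exists_finset : ∀ y : E, ∃ X : Finset E, (∀ x ∈ X, HomLT x y) ∧
    ∀ (z : E) (f : z ⟶ y), HomLT z y →
      ∃ (n : ℕ) (x : Fin n → E) (g : ∀ i, z ⟶ x i) (h : ∀ i, x i ⟶ y),
        (∀ i, x i ∈ X) ∧ f = ∑ i, g i ≫ h i

/-- Left modules over a `k`-linear category `E`: covariant `k`-linear functors from `E` to
`k`-vector spaces, with natural transformations as morphisms. -/
abbrev LeftModuleCat (k : Type u) [Field k] (E : Type v) [Category.{w} E] [Preadditive E]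
    [CategoryTheory.Linear k E] :=
  ObjectProperty.FullSubcategory
    (fun F : E ⥤ ModuleCat.{t} k => F.Additive ∧ F.Linear k)

/-! ### The coalgebra of a locally finite linear category -/

/-- The vector space `⨁_{x, y} Hom(x, y)^*`. -/
def CatCoalgebra (k : Type u) [Field k] (E : Type v) [Category.{w} E] [Preadditive E]
    [CategoryTheory.Linear k E] : Type (max u v w) :=
  ⨁ p : E × E, Module.Dual k (p.1 ⟶ p.2)

namespace CatCoalgebra

variable (k : Type u) [Field k] {E : Type v} [Category.{w} E] [Preadditive E]
  [CategoryTheory.Linear k E]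

instance : AddCommGroup (CatCoalgebra k E) :=
  inferInstanceAs (AddCommGroup (⨁ p : E × E, Module.Dual k (p.1 ⟶ p.2)))

instance : Module k (CatCoalgebra k E) :=
  inferInstanceAs (Module k (⨁ p : E × E, Module.Dual k (p.1 ⟶ p.2)))

open Classical in
/-- The inclusion of the direct summand `Hom(x, y)^*`. -/
def incl (x y : E) : Module.Dual k (x ⟶ y) →ₗ[k] CatCoalgebra k E :=
  DirectSum.lof k (E × E) (fun p => Module.Dual k (p.1 ⟶ p.2)) (x, y)

/-- The projection onto the direct summand `Hom(x, y)^*`. -/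
def proj (x y : E) : CatCoalgebra k E →ₗ[k] Module.Dual k (x ⟶ y) :=
  DirectSum.component k (E × E) (fun p => Module.Dual k (p.1 ⟶ p.2)) (x, y)

open Classical in
/-- The linear map out of `⨁_{x, y} Hom(x, y)^*` with given components. -/
def desc {M : Type t} [AddCommGroup M] [Module k M]
    (φ : ∀ x y : E, Module.Dual k (x ⟶ y) →ₗ[k] M) : CatCoalgebra k E →ₗ[k] M :=
  DirectSum.toModule k (E × E) M (fun p => φ p.1 p.2)

variable {k}

@[simp]
lemma desc_incl {M : Type t} [AddCommGroup M] [Module k M]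
    (φ : ∀ x y : E, Module.Dual k (x ⟶ y) →ₗ[k] M) (x y : E) (a : Module.Dual k (x ⟶ y)) :
    desc k φ (incl k x y a) = φ x y a := by
  classical
  exact DirectSum.toModule_lof (M := fun p : E × E => Module.Dual k (p.1 ⟶ p.2)) k (x, y) a

@[simp]
lemma proj_incl_self (x y : E) (a : Module.Dual k (x ⟶ y)) :
    proj k x y (incl k x y a) = a := by
  classical
  exact DirectSum.component.lof_self (M := fun p : E × E => Module.Dual k (p.1 ⟶ p.2)) k (x, y) a

lemma proj_incl_ne (x y x' y' : E) (h : (x, y) ≠ (x', y')) (a : Module.Dual k (x ⟶ y)) :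
    proj k x' y' (incl k x y a) = 0 := by
  classical
  exact (DirectSum.component.of (M := fun p : E × E => Module.Dual k (p.1 ⟶ p.2)) k
    (x', y') (x, y) a).trans (dif_neg h)

lemma hom_ext {M : Type t} [AddCommGroup M] [Module k M] {f g : CatCoalgebra k E →ₗ[k] M}
    (h : ∀ (x y : E) (a : Module.Dual k (x ⟶ y)), f (incl k x y a) = g (incl k x y a)) :
    f = g := by
  classical
  exact DirectSum.linearMap_ext k (fun p => LinearMap.ext fun a => h p.1 p.2 a)

variable (k) in
/-- The linear function on `⨁_{x, y} Hom(x, y)^*` given by the pairing with `f ∈ Hom(x, y)` on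
the direct summand `Hom(x, y)^*`, and by zero on all the other summands. -/
def ev {x y : E} (f : x ⟶ y) : CatCoalgebra k E →ₗ[k] k :=
  Module.Dual.eval k (x ⟶ y) f ∘ₗ proj k x y

open Classical in
variable (k E) in
/-- The counit: the pairing with `𝟙 x` on `Hom(x, x)^*`, zero on `Hom(x, y)^*` for `x ≠ y`. -/
def counitMap : CatCoalgebra k E →ₗ[k] k :=
  desc k fun x y =>
    if h : x = y then Module.Dual.eval k (x ⟶ y) (eqToHom h) else 0

lemma counitMap_incl_self (x : E) (a : Module.Dual k (x ⟶ x)) :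
    counitMap k E (incl k x x a) = a (𝟙 x) := by
  simp [counitMap]

lemma counitMap_incl_ne {x y : E} (h : x ≠ y) (a : Module.Dual k (x ⟶ y)) :
    counitMap k E (incl k x y a) = 0 := by
  simp [counitMap, h]

lemma ev_incl_self {x y : E} (f : x ⟶ y) (a : Module.Dual k (x ⟶ y)) :
    ev k f (incl k x y a) = a f := by
  simp [ev]

lemma ev_incl_ne {x y x' y' : E} (f : x ⟶ y) (h : (x', y') ≠ (x, y))
    (a : Module.Dual k (x' ⟶ y')) : ev k f (incl k x' y' a) = 0 := by
  simp [ev, proj_incl_ne _ _ _ _ h]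

lemma ev_add {x y : E} (f g : x ⟶ y) : ev k (f + g) = ev k f + ev k g := by
  ext c
  simp [ev]

lemma ev_smul {x y : E} (r : k) (f : x ⟶ y) : ev k (r • f) = r • ev k f := by
  ext c
  simp [ev]

lemma ev_zero {x y : E} : ev k (0 : x ⟶ y) = 0 := by
  ext c
  simp [ev]

lemma lid_map_eval {V W : Type*} [AddCommGroup V] [Module k V] [AddCommGroup W] [Module k W]
    (t : Module.Dual k V ⊗[k] Module.Dual k W) (f : V) (g : W) :
    TensorProduct.lid k _ ((Module.Dual.eval k V f).rTensor _ t) g =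
      TensorProduct.dualDistrib k V W t (f ⊗ₜ g) := by
  induction t with
  | zero => simp
  | tmul a b => simp
  | add a b ha hb => simp only [map_add, LinearMap.add_apply, ha, hb]

lemma rid_map_eval {V W : Type*} [AddCommGroup V] [Module k V] [AddCommGroup W] [Module k W]
    (t : Module.Dual k V ⊗[k] Module.Dual k W) (f : V) (g : W) :
    TensorProduct.rid k _ ((Module.Dual.eval k W g).lTensor _ t) f =
      TensorProduct.dualDistrib k V W t (f ⊗ₜ g) := by
  induction t with
  | zero => simp
  | tmul a b => simp [mul_comm]
  | add a b ha hb => simp only [map_add, LinearMap.add_apply, ha, hb]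

lemma mul'_map_eval {V W : Type*} [AddCommGroup V] [Module k V] [AddCommGroup W] [Module k W]
    (t : Module.Dual k V ⊗[k] Module.Dual k W) (f : V) (g : W) :
    LinearMap.mul' k k (TensorProduct.map (Module.Dual.eval k V f) (Module.Dual.eval k W g) t) =
      TensorProduct.dualDistrib k V W t (f ⊗ₜ g) := by
  induction t with
  | zero => simp
  | tmul a b => simp
  | add a b ha hb => simp only [map_add, LinearMap.add_apply, ha, hb]

section Tensor

variable {A B D A' B' D' U V W M : Type*} [AddCommGroup A] [Module k A] [AddCommGroup B]
  [Module k B] [AddCommGroup D] [Module k D] [AddCommGroup A'] [Module k A'] [AddCommGroup B']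
  [Module k B'] [AddCommGroup D'] [Module k D'] [AddCommGroup U] [Module k U] [AddCommGroup V]
  [Module k V] [AddCommGroup W] [Module k W] [AddCommGroup M] [Module k M]

lemma assoc_map_map (i : A →ₗ[k] A') (j : B →ₗ[k] B') (l : D →ₗ[k] D') (s : A ⊗[k] B) (d : D) :
    TensorProduct.assoc k A' B' D' (TensorProduct.map i j s ⊗ₜ l d) =
      TensorProduct.map i (TensorProduct.map j l) (TensorProduct.assoc k A B D (s ⊗ₜ d)) := by
  induction s with
  | zero => simp
  | tmul b c => simp
  | add a b ha hb => simp only [TensorProduct.add_tmul, map_add, ha, hb]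

lemma dualDistrib_assoc_tmul (s : Module.Dual k U ⊗[k] Module.Dual k V) (c : Module.Dual k W)
    (f : U) (g : V) (h : W) :
    TensorProduct.dualDistrib k U (V ⊗[k] W)
      ((TensorProduct.dualDistrib k V W).lTensor _ (TensorProduct.assoc k _ _ _ (s ⊗ₜ c)))
        (f ⊗ₜ (g ⊗ₜ h)) =
      TensorProduct.dualDistrib k U V s (f ⊗ₜ g) * c h := by
  induction s with
  | zero => simp only [TensorProduct.zero_tmul, LinearMap.map_zero, LinearEquiv.map_zero, LinearMap.zero_apply, zero_mul]
  | tmul a b => simp [mul_assoc]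
  | add a b ha hb =>
    simp only [TensorProduct.add_tmul, LinearMap.map_add, LinearEquiv.map_add, LinearMap.add_apply, ha, hb, add_mul]

lemma dualDistrib_assoc_rTensor (q : Module.Dual k M →ₗ[k] Module.Dual k U ⊗[k] Module.Dual k V)
    (f : U) (g : V) (h : W) (m : M)
    (hq : ∀ a, TensorProduct.dualDistrib k U V (q a) (f ⊗ₜ g) = a m)
    (t : Module.Dual k M ⊗[k] Module.Dual k W) :
    TensorProduct.dualDistrib k U (V ⊗[k] W)
      ((TensorProduct.dualDistrib k V W).lTensor _
        (TensorProduct.assoc k _ _ _ (q.rTensor _ t))) (f ⊗ₜ (g ⊗ₜ h)) =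
      TensorProduct.dualDistrib k M W t (m ⊗ₜ h) := by
  induction t with
  | zero => simp only [LinearMap.map_zero, LinearEquiv.map_zero, LinearMap.zero_apply]
  | tmul b c => rw [LinearMap.rTensor_tmul, dualDistrib_assoc_tmul, hq]; simp
  | add a b ha hb => simp only [LinearMap.map_add, LinearEquiv.map_add, LinearMap.add_apply, ha, hb]

lemma dualDistrib_lTensor (q : Module.Dual k M →ₗ[k] Module.Dual k V ⊗[k] Module.Dual k W)
    (f : U) (g : V) (h : W) (m : M)
    (hq : ∀ a, TensorProduct.dualDistrib k V W (q a) (g ⊗ₜ h) = a m)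
    (t : Module.Dual k U ⊗[k] Module.Dual k M) :
    TensorProduct.dualDistrib k U (V ⊗[k] W)
      ((TensorProduct.dualDistrib k V W).lTensor _ (q.lTensor _ t)) (f ⊗ₜ (g ⊗ₜ h)) =
      TensorProduct.dualDistrib k U M t (f ⊗ₜ m) := by
  induction t with
  | zero => simp
  | tmul b c =>
    rw [LinearMap.lTensor_tmul, LinearMap.lTensor_tmul, TensorProduct.dualDistrib_apply, hq]
    simp
  | add a b ha hb => simp only [map_add, LinearMap.add_apply, ha, hb]

lemma dualDistrib_injective [FiniteDimensional k V] [FiniteDimensional k W] :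
    Function.Injective (TensorProduct.dualDistrib k V W) :=
  (TensorProduct.dualDistribEquiv k V W).injective

lemma dualDistrib_lTensor_injective [FiniteDimensional k U] [FiniteDimensional k V]
    [FiniteDimensional k W] :
    Function.Injective (TensorProduct.dualDistrib k U (V ⊗[k] W) ∘ₗ
      (TensorProduct.dualDistrib k V W).lTensor (Module.Dual k U)) := by
  rw [LinearMap.coe_comp]
  exact dualDistrib_injective.comp
    (Module.Flat.lTensor_preserves_injective_linearMap _ dualDistrib_injective)

lemma coassoc_ext [FiniteDimensional k U] [FiniteDimensional k V] [FiniteDimensional k W]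
    {s t : Module.Dual k U ⊗[k] (Module.Dual k V ⊗[k] Module.Dual k W)}
    (hst : ∀ f g h, TensorProduct.dualDistrib k U (V ⊗[k] W)
      ((TensorProduct.dualDistrib k V W).lTensor _ s) (f ⊗ₜ (g ⊗ₜ h)) =
        TensorProduct.dualDistrib k U (V ⊗[k] W)
      ((TensorProduct.dualDistrib k V W).lTensor _ t) (f ⊗ₜ (g ⊗ₜ h))) : s = t :=
  dualDistrib_lTensor_injective (TensorProduct.ext_threefold' hst)

end Tensor

variable [LocallyFiniteCat k E]

instance (x y : E) : FiniteDimensional k (x ⟶ y) := LocallyFiniteCat.finite_hom x y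

variable (k) in
/-- The component `Hom(x, y)^* → Hom(x, z)^* ⊗ Hom(z, y)^*` of the comultiplication: the map
dual to the composition `f ⊗ g ↦ f ≫ g`. -/
def comulComp (x z y : E) :
    Module.Dual k (x ⟶ y) →ₗ[k] Module.Dual k (x ⟶ z) ⊗[k] Module.Dual k (z ⟶ y) :=
  (TensorProduct.dualDistribEquiv k (x ⟶ z) (z ⟶ y)).symm.toLinearMap ∘ₗ
    (TensorProduct.lift (CategoryTheory.Linear.comp x z y)).dualMap

variable (k E) in
/-- The comultiplication: the sum over the finitely many `z` with `x ⪯ z ⪯ y` of the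
maps `Hom(x, y)^* → Hom(x, z)^* ⊗ Hom(z, y)^*`. -/
def comulMap : CatCoalgebra k E →ₗ[k] CatCoalgebra k E ⊗[k] CatCoalgebra k E :=
  desc k fun x y =>
    ∑ z ∈ (LocallyFiniteCat.finite_interval k x y).toFinset,
      TensorProduct.map (incl k x z) (incl k z y) ∘ₗ comulComp k x z y


lemma comulMap_incl (x y : E) (a : Module.Dual k (x ⟶ y)) :
    comulMap k E (incl k x y a) =
      ∑ z ∈ (LocallyFiniteCat.finite_interval k x y).toFinset,
        TensorProduct.map (incl k x z) (incl k z y) (comulComp k x z y a) := by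
  simp [comulMap]

lemma dualDistrib_comulComp (x z y : E) (a : Module.Dual k (x ⟶ y)) (f : x ⟶ z) (g : z ⟶ y) :
    TensorProduct.dualDistrib k (x ⟶ z) (z ⟶ y) (comulComp k x z y a) (f ⊗ₜ g) =
      a (f ≫ g) := by
  have h : TensorProduct.dualDistrib k (x ⟶ z) (z ⟶ y) (comulComp k x z y a) =
      (TensorProduct.lift (CategoryTheory.Linear.comp x z y)).dualMap a :=
    (TensorProduct.dualDistribEquiv k (x ⟶ z) (z ⟶ y)).apply_symm_apply _
  rw [h]
  simp [CategoryTheory.Linear.comp]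

lemma comulComp_coassoc (x z w y : E) (a : Module.Dual k (x ⟶ y)) :
    TensorProduct.assoc k _ _ _ ((comulComp k x z w).rTensor _ (comulComp k x w y a)) =
      (comulComp k z w y).lTensor _ (comulComp k x z y a) := by
  refine coassoc_ext fun f g h => ?_
  rw [dualDistrib_assoc_rTensor _ f g h (f ≫ g) (fun a => dualDistrib_comulComp x z w a f g),
    dualDistrib_lTensor _ f g h (g ≫ h) (fun a => dualDistrib_comulComp z w y a g h),
    dualDistrib_comulComp, dualDistrib_comulComp, Category.assoc]

lemma mem_interval (x y z : E) :
    z ∈ (LocallyFiniteCat.finite_interval k x y).toFinset ↔ HomLE x z ∧ HomLE z y := by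
  simp

lemma homLE_of_ne_zero {E : Type v} [Category.{w} E] [Preadditive E] {x y : E} {f : x ⟶ y}
    (hf : f ≠ 0) : HomLE x y :=
  Relation.TransGen.single ⟨f, hf⟩

lemma coassoc_aux :
    (TensorProduct.assoc k (CatCoalgebra k E) (CatCoalgebra k E) (CatCoalgebra k E)).toLinearMap ∘ₗ
      (comulMap k E).rTensor (CatCoalgebra k E) ∘ₗ comulMap k E =
      (comulMap k E).lTensor (CatCoalgebra k E) ∘ₗ comulMap k E := by
  apply hom_ext
  intro x y a
  have hL (w : E) (t : Module.Dual k (x ⟶ w) ⊗[k] Module.Dual k (w ⟶ y)) :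
      TensorProduct.assoc k (CatCoalgebra k E) (CatCoalgebra k E) (CatCoalgebra k E)
        ((comulMap k E).rTensor _ (TensorProduct.map (incl k x w) (incl k w y) t)) =
      ∑ z ∈ (LocallyFiniteCat.finite_interval k x w).toFinset,
        TensorProduct.map (incl k x z) (TensorProduct.map (incl k z w) (incl k w y))
          (TensorProduct.assoc k _ _ _ ((comulComp k x z w).rTensor _ t)) := by
    induction t with
    | zero => simp only [LinearMap.map_zero, LinearEquiv.map_zero, Finset.sum_const_zero]
    | tmul b c =>
      simp only [TensorProduct.map_tmul, LinearMap.rTensor_tmul, comulMap_incl,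
        TensorProduct.sum_tmul, map_sum]
      exact Finset.sum_congr rfl fun z _ => assoc_map_map _ _ _ _ _
    | add a b ha hb => simp only [LinearMap.map_add, LinearEquiv.map_add, ha, hb, Finset.sum_add_distrib]
  have hR (z : E) (t : Module.Dual k (x ⟶ z) ⊗[k] Module.Dual k (z ⟶ y)) :
      (comulMap k E).lTensor _ (TensorProduct.map (incl k x z) (incl k z y) t) =
      ∑ w ∈ (LocallyFiniteCat.finite_interval k z y).toFinset,
        TensorProduct.map (incl k x z) (TensorProduct.map (incl k z w) (incl k w y))
          ((comulComp k z w y).lTensor _ t) := by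
    induction t with
    | zero => simp
    | tmul b c =>
      simp only [TensorProduct.map_tmul, LinearMap.lTensor_tmul, comulMap_incl,
        TensorProduct.tmul_sum]
    | add a b ha hb => simp only [map_add, ha, hb, Finset.sum_add_distrib]
  simp only [LinearMap.comp_apply, LinearEquiv.coe_coe, comulMap_incl, map_sum, hL, hR,
    comulComp_coassoc]
  refine Finset.sum_comm' fun w z => ?_
  simp only [Set.Finite.mem_toFinset, Set.mem_ofPred_eq]
  constructor
  · rintro ⟨⟨h1, h2⟩, h3, h4⟩
    exact ⟨⟨h4, h2⟩, h3, h4.trans h2⟩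
  · rintro ⟨⟨h1, h2⟩, h3, h4⟩
    exact ⟨⟨h3.trans h1, h2⟩, h3, h1⟩

lemma rTensor_counit_aux :
    (counitMap k E).rTensor (CatCoalgebra k E) ∘ₗ comulMap k E =
      TensorProduct.mk k k (CatCoalgebra k E) 1 := by
  apply hom_ext
  intro x y a
  have h0 (z : E) (t : Module.Dual k (x ⟶ z) ⊗[k] Module.Dual k (z ⟶ y)) (hz : z ≠ x) :
      (counitMap k E).rTensor _ (TensorProduct.map (incl k x z) (incl k z y) t) = 0 := by
    induction t with
    | zero => simp
    | tmul b c => simp [counitMap_incl_ne hz.symm]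
    | add a b ha hb => simp only [map_add, ha, hb, add_zero]
  have h1 (t : Module.Dual k (x ⟶ x) ⊗[k] Module.Dual k (x ⟶ y)) :
      (counitMap k E).rTensor _ (TensorProduct.map (incl k x x) (incl k x y) t) =
      1 ⊗ₜ incl k x y (TensorProduct.lid k _ ((Module.Dual.eval k (x ⟶ x) (𝟙 x)).rTensor _ t)) := by
    induction t with
    | zero => simp
    | tmul b c => simp [counitMap_incl_self, TensorProduct.smul_tmul']
    | add a b ha hb => simp only [map_add, ha, hb, TensorProduct.tmul_add]
  have h2 : TensorProduct.lid k _ ((Module.Dual.eval k (x ⟶ x) (𝟙 x)).rTensor _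
      (comulComp k x x y a)) = a := by
    ext g
    rw [lid_map_eval, dualDistrib_comulComp, Category.id_comp]
  simp only [LinearMap.comp_apply, comulMap_incl, map_sum, TensorProduct.mk_apply]
  rw [Finset.sum_eq_single x (fun z _ hz => h0 z _ hz), h1, h2]
  intro hx
  have ha : a = 0 := by
    ext f
    by_contra hf
    have hf0 : f ≠ 0 := fun h => hf (by simp [h])
    have hid : 𝟙 x ≠ 0 := fun h => hf0 (by rw [← Category.id_comp f, h, Limits.zero_comp])
    exact hx ((mem_interval (k := k) x y x).2 ⟨homLE_of_ne_zero hid, homLE_of_ne_zero hf0⟩)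
  simp [ha]

lemma lTensor_counit_aux :
    (counitMap k E).lTensor (CatCoalgebra k E) ∘ₗ comulMap k E =
      (TensorProduct.mk k (CatCoalgebra k E) k).flip 1 := by
  apply hom_ext
  intro x y a
  have h0 (z : E) (t : Module.Dual k (x ⟶ z) ⊗[k] Module.Dual k (z ⟶ y)) (hz : z ≠ y) :
      (counitMap k E).lTensor _ (TensorProduct.map (incl k x z) (incl k z y) t) = 0 := by
    induction t with
    | zero => simp
    | tmul b c => simp [counitMap_incl_ne hz]
    | add a b ha hb => simp only [map_add, ha, hb, add_zero]
  have h1 (t : Module.Dual k (x ⟶ y) ⊗[k] Module.Dual k (y ⟶ y)) :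
      (counitMap k E).lTensor _ (TensorProduct.map (incl k x y) (incl k y y) t) =
      incl k x y (TensorProduct.rid k _ ((Module.Dual.eval k (y ⟶ y) (𝟙 y)).lTensor _ t))
        ⊗ₜ 1 := by
    induction t with
    | zero => simp
    | tmul b c => simp [counitMap_incl_self, TensorProduct.smul_tmul]
    | add a b ha hb => simp only [map_add, ha, hb, TensorProduct.add_tmul]
  have h2 : TensorProduct.rid k _ ((Module.Dual.eval k (y ⟶ y) (𝟙 y)).lTensor _
      (comulComp k x y y a)) = a := by
    ext g
    rw [rid_map_eval, dualDistrib_comulComp, Category.comp_id]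
  simp only [LinearMap.comp_apply, comulMap_incl, map_sum, LinearMap.flip_apply,
    TensorProduct.mk_apply]
  rw [Finset.sum_eq_single y (fun z _ hz => h0 z _ hz), h1, h2]
  intro hy
  have ha : a = 0 := by
    ext f
    by_contra hf
    have hf0 : f ≠ 0 := fun h => hf (by simp [h])
    have hid : 𝟙 y ≠ 0 := fun h => hf0 (by rw [← Category.comp_id f, h, Limits.comp_zero])
    exact hy ((mem_interval (k := k) x y y).2 ⟨homLE_of_ne_zero hf0, homLE_of_ne_zero hid⟩)
  simp [ha]

instance : Coalgebra k (CatCoalgebra k E) where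
  comul := comulMap k E
  counit := counitMap k E
  coassoc := coassoc_aux
  rTensor_counit_comp_comul := rTensor_counit_aux
  lTensor_counit_comp_comul := lTensor_counit_aux

lemma ev_comp {x z y : E} (f : x ⟶ z) (g : z ⟶ y) :
    LinearMap.mul' k k ∘ₗ TensorProduct.map (ev k f) (ev k g) ∘ₗ Coalgebra.comul =
      ev k (f ≫ g) := by
  apply hom_ext
  intro x' y' a
  have h0 (z' : E) (t : Module.Dual k (x' ⟶ z') ⊗[k] Module.Dual k (z' ⟶ y'))
      (hne : (x', z') ≠ (x, z) ∨ (z', y') ≠ (z, y)) :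
      TensorProduct.map (ev k f) (ev k g)
        (TensorProduct.map (incl k x' z') (incl k z' y') t) = 0 := by
    induction t with
    | zero => simp
    | tmul b c =>
      rcases hne with h | h
      · simp [ev_incl_ne f h]
      · simp [ev_incl_ne g h]
    | add a b ha hb => simp only [map_add, ha, hb, add_zero]
  have h1 (t : Module.Dual k (x ⟶ z) ⊗[k] Module.Dual k (z ⟶ y)) :
      TensorProduct.map (ev k f) (ev k g) (TensorProduct.map (incl k x z) (incl k z y) t) =
      TensorProduct.map (Module.Dual.eval k (x ⟶ z) f) (Module.Dual.eval k (z ⟶ y) g) t := by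
    induction t with
    | zero => simp
    | tmul b c => simp [ev_incl_self]
    | add a b ha hb => simp only [map_add, ha, hb]
  change LinearMap.mul' k k (TensorProduct.map (ev k f) (ev k g) (comulMap k E _)) = _
  rw [comulMap_incl, map_sum, map_sum]
  by_cases hxy : (x', y') = (x, y)
  · obtain ⟨rfl, rfl⟩ := Prod.mk.inj hxy
    rw [Finset.sum_eq_single z, h1, mul'_map_eval, dualDistrib_comulComp, ev_incl_self]
    · intro z' _ hz'
      rw [h0 z' _ (Or.inl fun h => hz' (Prod.mk.inj h).2), map_zero]
    · intro hz
      rw [h1, mul'_map_eval, dualDistrib_comulComp]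
      by_contra hne
      have hfg : f ≫ g ≠ 0 := fun h => hne (by simp [h])
      exact hz ((mem_interval (k := k) _ _ _).2
        ⟨homLE_of_ne_zero (f := f) fun h => hfg (by rw [h, Limits.zero_comp]),
          homLE_of_ne_zero (f := g) fun h => hfg (by rw [h, Limits.comp_zero])⟩)
  · rw [ev_incl_ne _ hxy]
    refine Finset.sum_eq_zero fun z' _ => ?_
    rw [h0 z', map_zero]
    by_contra! hcon
    exact hxy (by rw [(Prod.mk.inj hcon.1).1, (Prod.mk.inj hcon.2).2])

end CatCoalgebra

/-! ### The contramodule forgetful functor -/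

namespace ContraForget

open CatCoalgebra

variable {k : Type u} [Field k] {E : Type v} [Category.{w} E] [Preadditive E]
  [CategoryTheory.Linear k E] [LocallyFiniteCat k E]

/-- The component of a contramodule at the object `x`: the image of the idempotent operator
`p ↦ π (c ↦ ev (𝟙 x) c • p)`. -/
def component (P : LeftContramodule.{t} k (CatCoalgebra k E)) (x : E) :
    Submodule k P.carrier :=
  LinearMap.range (P.act (ev k (𝟙 x)))

lemma act_ev_act_ev (P : LeftContramodule.{t} k (CatCoalgebra k E)) {x y z : E} (f : x ⟶ y)
    (g : y ⟶ z) (p : P.carrier) :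
    P.act (ev k g) (P.act (ev k f) p) = P.act (ev k (f ≫ g)) p := by
  rw [P.act_act, ev_comp]

lemma act_mem (P : LeftContramodule.{t} k (CatCoalgebra k E)) {x y : E} (f : x ⟶ y)
    (p : P.carrier) : P.act (ev k f) p ∈ component P y :=
  ⟨P.act (ev k f) p, by rw [act_ev_act_ev, Category.comp_id]⟩

lemma act_id (P : LeftContramodule.{t} k (CatCoalgebra k E)) {x : E} (p : P.carrier)
    (hp : p ∈ component P x) : P.act (ev k (𝟙 x)) p = p := by
  obtain ⟨q, rfl⟩ := hp
  rw [act_ev_act_ev, Category.comp_id]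

/-- The action of a morphism `f : x ⟶ y` on the components of a contramodule: `p` goes to the
image under the contraaction of the map that is `c ↦ c f • p` on the direct summand
`Hom(x, y)^*` and zero on all the other summands. -/
def actHom (P : LeftContramodule.{t} k (CatCoalgebra k E)) {x y : E} (f : x ⟶ y) :
    component P x →ₗ[k] component P y :=
  (P.act (ev k f)).restrict fun p _ => act_mem P f p

/-- The `E`-module of the components of a contramodule. -/
def toModule (P : LeftContramodule.{t} k (CatCoalgebra k E)) : E ⥤ ModuleCat.{t} k where
  obj x := ModuleCat.of k (component P x)
  map f := ModuleCat.ofHom (actHom P f)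
  map_id x := by
    refine ModuleCat.hom_ext (LinearMap.ext fun p => Subtype.ext ?_)
    exact act_id P _ p.2
  map_comp f g := by
    refine ModuleCat.hom_ext (LinearMap.ext fun p => Subtype.ext ?_)
    exact (act_ev_act_ev P f g _).symm

instance (P : LeftContramodule.{t} k (CatCoalgebra k E)) : (toModule P).Additive where
  map_add {x y f g} := by
    ext p
    apply Subtype.ext
    change P.act (ev k (f + g)) p.1 = P.act (ev k f) p.1 + P.act (ev k g) p.1
    rw [ev_add, LeftContramodule.act_add]

instance (P : LeftContramodule.{t} k (CatCoalgebra k E)) : (toModule P).Linear k where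
  map_smul {x y} f r := by
    ext p
    apply Subtype.ext
    change P.act (ev k (r • f)) p.1 = r • P.act (ev k f) p.1
    rw [ev_smul, LeftContramodule.act_smul]

/-- The restriction of a morphism of contramodules to the components. -/
def mapComponent {P Q : LeftContramodule.{t} k (CatCoalgebra k E)} (φ : P ⟶ Q) (x : E) :
    component P x →ₗ[k] component Q x :=
  (LeftContramodule.Hom.toLin φ).restrict fun p hp => by
    rw [← act_id P p hp, LeftContramodule.Hom.map_act φ]
    exact act_mem Q _ _

end ContraForget

/-- The contramodule forgetful functor from left contramodules over the coalgebra of a locally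
finite `k`-linear category `E` to left `E`-modules. -/
def contraForget (k : Type u) [Field k] (E : Type v) [Category.{w} E] [Preadditive E]
    [CategoryTheory.Linear k E] [LocallyFiniteCat k E] :
    LeftContramodule.{t} k (CatCoalgebra k E) ⥤ LeftModuleCat.{t} k E where
  obj P := ⟨ContraForget.toModule P, inferInstance, inferInstance⟩
  map φ := ObjectProperty.homMk
    { app := fun x => ModuleCat.ofHom (ContraForget.mapComponent φ x)
      naturality := fun x y f => by
        ext p
        exact Subtype.ext (LeftContramodule.Hom.map_act φ _ _) }
  map_id P := rfl
  map_comp φ ψ := rfl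

end

/-! A contramodule is the product of its components, the images of the operators `P.act (ev k (𝟙
x))`: an element is determined by its components (`eq_zero_of_act_ev_id`), and any family of
components is realized (`exists_act_ev_id_eq`). Hence a contramodule morphism is determined by its
restrictions to components, which is faithfulness, and a morphism of modules assembles into a linear
map `φ` on the products that commutes with the action of every morphism of `E`. What remains for
fullness is that `φ` commutes with the contraaction, that is, with infinite combinations.

Let `defect φ` send `g` to `φ (P.π g) - Q.π (φ ∘ₗ g)`. Finite combinations contribute nothing,
because Hom spaces are finite-dimensional (`defect_eq_zero_of_finite`). The component of `defect φ
g` at `y` involves only the summands `Hom(x, y)^*`, and those with `x ⪯ y` but not `x ≺ y` have `x`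
in the finite interval from `y` to `y`, so only `x ≺ y` matters (`act_ev_id_defect`). There strict
local finiteness factors every morphism through the finite set `X_y`. Dually, by
contraassociativity, the infinite combination becomes a finite combination of infinite ones
(`exists_lift_comul_eq_below`). Since `φ` respects the outer finite one, the component at `y` of a
defect is a combination of defects with coefficients in `Hom(x, y)`, `x ∈ X_y`. A Nakayama argument
(`eq_zero_of_act_ev_id_eq_π`) then makes the defect vanish. -/

/-! ### Bilinear maps evaluated on the comultiplication -/

namespace CatCoalgebra

variable {k : Type u} [Field k] {E : Type v} [Category.{w} E] [Preadditive E]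
  [CategoryTheory.Linear k E] [LocallyFiniteCat k E] {M : Type t} [AddCommGroup M] [Module k M]

lemma comulComp_eq_zero {x y z : E}
    (h : z ∉ (LocallyFiniteCat.finite_interval k x y).toFinset) (a : Module.Dual k (x ⟶ y)) :
    comulComp k x z y a = 0 := by
  apply dualDistrib_injective
  rw [map_zero]
  refine TensorProduct.ext' fun f g => ?_
  rw [dualDistrib_comulComp]
  by_contra hne
  have hfg : f ≫ g ≠ 0 := fun h => hne (by simp [h])
  exact h ((mem_interval (k := k) _ _ _).2
    ⟨homLE_of_ne_zero (f := f) fun h => hfg (by rw [h, Limits.zero_comp]),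
      homLE_of_ne_zero (f := g) fun h => hfg (by rw [h, Limits.comp_zero])⟩)

lemma lift_comul_incl (B : CatCoalgebra k E →ₗ[k] CatCoalgebra k E →ₗ[k] M) (x y : E)
    (a : Module.Dual k (x ⟶ y)) :
    TensorProduct.lift B (Coalgebra.comul (R := k) (incl k x y a)) =
      ∑ z ∈ (LocallyFiniteCat.finite_interval k x y).toFinset,
        TensorProduct.lift (B.compl₁₂ (incl k x z) (incl k z y)) (comulComp k x z y a) := by
  change TensorProduct.lift B (comulMap k E _) = _
  rw [comulMap_incl, map_sum]
  refine Finset.sum_congr rfl fun z _ => ?_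
  rw [← LinearMap.comp_apply]
  congr 1
  exact TensorProduct.ext' fun u v => by simp

/-- No condition that `z` lies in the interval is needed: outside it the component of the
comultiplication through `z` is zero, as all composites through `z` vanish. -/
lemma lift_comul_incl_eq_single (B : CatCoalgebra k E →ₗ[k] CatCoalgebra k E →ₗ[k] M)
    (x z y : E) (a : Module.Dual k (x ⟶ y))
    (hB : ∀ z', z' ≠ z → ∀ u v, B (incl k x z' u) (incl k z' y v) = 0) :
    TensorProduct.lift B (Coalgebra.comul (R := k) (incl k x y a)) =
      TensorProduct.lift (B.compl₁₂ (incl k x z) (incl k z y)) (comulComp k x z y a) := by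
  rw [lift_comul_incl]
  refine Finset.sum_eq_single z (fun z' _ hz' => ?_) fun hz => ?_
  · have : TensorProduct.lift (B.compl₁₂ (incl k x z') (incl k z' y)) = 0 :=
      TensorProduct.ext' fun u v => by simpa using hB z' hz' u v
    rw [this, LinearMap.zero_apply]
  · rw [comulComp_eq_zero hz, map_zero]

lemma lift_comulComp_id_left {x y : E}
    (B : Module.Dual k (x ⟶ x) →ₗ[k] Module.Dual k (x ⟶ y) →ₗ[k] M)
    (G : Module.Dual k (x ⟶ y) →ₗ[k] M) (hB : ∀ u v, B u v = u (𝟙 x) • G v)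
    (a : Module.Dual k (x ⟶ y)) :
    TensorProduct.lift B (comulComp k x x y a) = G a := by
  have h1 (t : Module.Dual k (x ⟶ x) ⊗[k] Module.Dual k (x ⟶ y)) : TensorProduct.lift B t =
      G (TensorProduct.lid k _ ((Module.Dual.eval k (x ⟶ x) (𝟙 x)).rTensor _ t)) := by
    induction t with
    | zero => simp
    | tmul b c => simp [hB]
    | add a b ha hb => simp only [map_add, ha, hb]
  rw [h1]
  congr 1
  ext g
  rw [lid_map_eval, dualDistrib_comulComp, Category.id_comp]

lemma lift_comulComp_id_right {x y : E}
    (B : Module.Dual k (x ⟶ y) →ₗ[k] Module.Dual k (y ⟶ y) →ₗ[k] M)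
    (G : Module.Dual k (x ⟶ y) →ₗ[k] M) (hB : ∀ u v, B u v = v (𝟙 y) • G u)
    (a : Module.Dual k (x ⟶ y)) :
    TensorProduct.lift B (comulComp k x y y a) = G a := by
  have h1 (t : Module.Dual k (x ⟶ y) ⊗[k] Module.Dual k (y ⟶ y)) : TensorProduct.lift B t =
      G (TensorProduct.rid k _ ((Module.Dual.eval k (y ⟶ y) (𝟙 y)).lTensor _ t)) := by
    induction t with
    | zero => simp
    | tmul b c => simp [hB]
    | add a b ha hb => simp only [map_add, ha, hb]
  rw [h1]
  congr 1
  ext g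
  rw [rid_map_eval, dualDistrib_comulComp, Category.comp_id]

end CatCoalgebra

/-! ### A contramodule as the product of its components -/

namespace LeftContramodule

open CatCoalgebra

variable {k : Type u} [Field k] {E : Type v} [Category.{w} E] [Preadditive E]
  [CategoryTheory.Linear k E] [LocallyFiniteCat k E]

-- Contraassociativity for the bilinear map `g(u) · v(𝟙 y)`: the right tensor factor must lie in
-- `Hom(y, y)^*`, which leaves only the summands of `g` with target `y`.
open Classical in
lemma act_ev_id_π (P : LeftContramodule.{t} k (CatCoalgebra k E))
    (g : CatCoalgebra k E →ₗ[k] P.carrier) (y : E) :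
    P.act (ev k (𝟙 y)) (P.π g) =
      P.π (desc k fun x w => if w = y then g ∘ₗ incl k x w else 0) := by
  have h := P.contraassoc ((ev k (𝟙 y)).smulRight g)
  have h1 : P.π ∘ₗ (ev k (𝟙 y)).smulRight g = (ev k (𝟙 y)).smulRight (P.π g) := by
    ext c
    simp
  rw [h1] at h
  rw [act_apply, ← h]
  congr 1
  refine hom_ext fun x w a => ?_
  rw [LinearMap.comp_apply, lift_comul_incl_eq_single _ x w w, desc_incl]
  · refine lift_comulComp_id_right _ _ (fun u v => ?_) a
    split_ifs with hw
    · subst hw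
      simp [ev_incl_self]
    · simp [ev_incl_ne (𝟙 y) (x' := w) (y' := w) (by simp [hw])]
  · intro z hz u v
    have : (z, w) ≠ (y, y) := fun h => hz ((Prod.mk.inj h).1.trans (Prod.mk.inj h).2.symm)
    simp [ev_incl_ne (𝟙 y) this]

/-- The mirror image, with the identity in the left tensor factor: only the component at the source
`x` of a value of `g` on `Hom(x, y)^*` affects the contraaction. -/
lemma π_eq_π_act_ev_id (P : LeftContramodule.{t} k (CatCoalgebra k E))
    (g : CatCoalgebra k E →ₗ[k] P.carrier) :
    P.π g = P.π (desc k fun x y => P.act (ev k (𝟙 x)) ∘ₗ g ∘ₗ incl k x y) := by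
  have h := P.contraassoc
    (desc k fun x y => LinearMap.smulRightₗ (ev k (𝟙 x)) ∘ₗ g ∘ₗ incl k x y)
  convert h using 2
  · refine hom_ext fun x y a => ?_
    rw [LinearMap.comp_apply, lift_comul_incl_eq_single _ x x y]
    · refine (lift_comulComp_id_left _ (g ∘ₗ incl k x y) (fun u v => ?_) a).symm
      simp [ev_incl_self]
    · intro z hz u v
      simp [ev_incl_ne (𝟙 z) (x' := x) (y' := z) (by simp [hz.symm])]
  · refine hom_ext fun x y a => ?_
    simp [act_apply]

lemma eq_zero_of_act_ev_id (P : LeftContramodule.{t} k (CatCoalgebra k E)) (p : P.carrier)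
    (hp : ∀ x : E, P.act (ev k (𝟙 x)) p = 0) : p = 0 := by
  rw [← P.contraunit p, π_eq_π_act_ev_id, ← map_zero P.π]
  congr 1
  refine hom_ext fun x y a => ?_
  simp [hp]

open Classical in
lemma exists_act_ev_id_eq (P : LeftContramodule.{t} k (CatCoalgebra k E)) (q : E → P.carrier) :
    ∃ p, ∀ x : E, P.act (ev k (𝟙 x)) p = P.act (ev k (𝟙 x)) (q x) := by
  -- The witness is the infinite sum of the `q x`: the contraaction on the counit with its value at
  -- `𝟙 x` weighted by `q x`.
  refine ⟨P.π (desc k fun x y => if h : x = y then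
    (Module.Dual.eval k (x ⟶ y) (eqToHom h)).smulRight (q x) else 0), fun x => ?_⟩
  rw [act_ev_id_π, act_apply]
  congr 1
  refine hom_ext fun z w a => ?_
  rw [desc_incl]
  by_cases hw : w = x
  · subst hw
    by_cases hz : z = w
    · subst hz
      simp [ev_incl_self]
    · simp [hz, ev_incl_ne (𝟙 w) (x' := z) (y' := w) (by simp [hz])]
  · simp [hw, ev_incl_ne (𝟙 x) (x' := z) (y' := w) (by simp [hw])]

lemma ext_act_ev_id (P : LeftContramodule.{t} k (CatCoalgebra k E)) {p q : P.carrier}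
    (h : ∀ x : E, P.act (ev k (𝟙 x)) p = P.act (ev k (𝟙 x)) q) : p = q :=
  sub_eq_zero.1 (P.eq_zero_of_act_ev_id _ fun x => by rw [map_sub, h, sub_self])

lemma act_ev_id_act_ev_of_ne (P : LeftContramodule.{t} k (CatCoalgebra k E)) {x y z : E}
    (h : z ≠ y) (f : x ⟶ y) (p : P.carrier) : P.act (ev k (𝟙 z)) (P.act (ev k f) p) = 0 := by
  classical
  rw [P.act_apply (ev k f), act_ev_id_π, ← map_zero P.π]
  congr 1
  refine hom_ext fun x' w a => ?_
  rw [desc_incl]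
  split_ifs with hw
  · subst hw
    simp [ev_incl_ne f (x' := x') (y' := w) (by simp [h])]
  · simp

end LeftContramodule

/-! ### Well-founded recursion and the Nakayama lemma -/

open Classical in
lemma WellFounded.exists_eq_apply {ι : Type*} {M : ι → Type*} [∀ i, Nonempty (M i)]
    {r : ι → ι → Prop} (hr : WellFounded r) (Φ : (∀ i, M i) → ∀ i, M i)
    (hΦ : ∀ T T' i, (∀ j, r j i → T j = T' j) → Φ T i = Φ T' i) :
    ∃ T, ∀ i, T i = Φ T i := by
  refine ⟨hr.fix fun i T => Φ (fun j => if h : r j i then T j h else Classical.arbitrary _) i,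
    fun i => ?_⟩
  rw [hr.fix_eq]
  exact hΦ _ _ i fun j hj => dif_pos hj

lemma HomLE.refl_left {E : Type v} [Category.{w} E] [Preadditive E] {x y : E}
    (h : HomLE x y) : HomLE x x := by
  obtain ⟨z, ⟨f, hf⟩, -⟩ := Relation.TransGen.head'_iff.1 h
  exact .single ⟨𝟙 x, fun h => hf (by rw [← Category.id_comp f, h, Limits.zero_comp])⟩

/-- The finite interval from `x` to `y` strictly shrinks when `x` is replaced by `z` with `x ≺ z ⪯
y`, since it loses `x`. -/
lemma HomLE.wellFounded_homLT (k : Type u) [Field k] {E : Type v} [Category.{w} E]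
    [Preadditive E] [CategoryTheory.Linear k E] [LocallyFiniteCat k E] (y : E) :
    WellFounded fun z x : E => HomLT x z ∧ HomLE z y := by
  refine Subrelation.wf (r := InvImage (· < ·)
    fun x => (LocallyFiniteCat.finite_interval k x y).toFinset.card) ?_ (InvImage.wf _ wellFounded_lt)
  rintro z x ⟨⟨hxz, hzx⟩, hzy⟩
  refine Finset.card_lt_card ((Finset.ssubset_iff_of_subset fun a ha => ?_).2 ⟨x, ?_, ?_⟩)
  · rw [CatCoalgebra.mem_interval (k := k)] at ha ⊢
    exact ⟨hxz.trans ha.1, ha.2⟩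
  · rw [CatCoalgebra.mem_interval (k := k)]
    exact ⟨hxz.refl_left, hxz.trans hzy⟩
  · rw [CatCoalgebra.mem_interval (k := k)]
    exact fun h => hzx h.1

namespace LeftContramodule

open CatCoalgebra

variable {k : Type u} [Field k] {E : Type v} [Category.{w} E] [Preadditive E]
  [CategoryTheory.Linear k E]

/-- A form of the contramodule Nakayama lemma: a map `D` into a contramodule vanishes if each
component of `D v` is an infinite combination of values of `D`, with coefficients in
morphisms from strictly smaller objects. -/
lemma eq_zero_of_act_ev_id_eq_π [LocallyFiniteCat k E]
    (Q : LeftContramodule.{t} k (CatCoalgebra k E))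
    {V : Type*} [AddCommGroup V] [Module k V] (D : V →ₗ[k] Q.carrier)
    (F : E → V →ₗ[k] CatCoalgebra k E →ₗ[k] V)
    (hD : ∀ y v, Q.act (ev k (𝟙 y)) (D v) = Q.π (D ∘ₗ F y v))
    (hF : ∀ x y v a, ¬ HomLT x y → F y v (incl k x y a) = 0) : D = 0 := by
  ext v
  -- Iterating `hD` formally expands `D v` into a series; `T` collects all its coefficients at once,
  -- as the solution of `T = ε v + (F ∘ T) * comul`. By `hF` the value at `x` uses only `z` with `x
  -- ≺ z ⪯ y`, so the recursion is well-founded.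
  have hT (y : E) : ∃ T : ∀ x : E, Module.Dual k (x ⟶ y) →ₗ[k] V, ∀ x, T x =
      (counitMap k E).smulRight v ∘ₗ incl k x y +
        ∑ z ∈ (LocallyFiniteCat.finite_interval k x y).toFinset,
          TensorProduct.lift ((F z ∘ₗ T z).flip ∘ₗ incl k x z) ∘ₗ comulComp k x z y := by
    refine (HomLE.wellFounded_homLT k y).exists_eq_apply
      (M := fun x => Module.Dual k (x ⟶ y) →ₗ[k] V) (fun T x =>
      (counitMap k E).smulRight v ∘ₗ incl k x y +
        ∑ z ∈ (LocallyFiniteCat.finite_interval k x y).toFinset,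
          TensorProduct.lift ((F z ∘ₗ T z).flip ∘ₗ incl k x z) ∘ₗ comulComp k x z y) ?_
    intro T T' x h
    congr 1
    refine Finset.sum_congr rfl fun z hz => ?_
    by_cases hxz : HomLT x z
    · rw [h z ⟨hxz, ((mem_interval (k := k) _ _ _).1 hz).2⟩]
    · congr 2
      ext u : 1
      refine LinearMap.ext fun b => ?_
      simp [hF x z _ _ hxz]
  choose T hT using hT
  have h := Q.contraassoc (desc k fun z y => LinearMap.compRight k D ∘ₗ F z ∘ₗ T y z)
  -- Only components at the source `z` count, and there `hD` rewrites `D`. With contraassociativity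
  -- and the equation for `T` this gives `π(D ∘ T) = D v + π(D ∘ T)`, hence `D v = 0`.
  have h1 : Q.π (Q.π ∘ₗ desc k fun z y => LinearMap.compRight k D ∘ₗ F z ∘ₗ T y z) =
      Q.π (D ∘ₗ desc k fun z y => T y z) := by
    rw [Q.π_eq_π_act_ev_id (D ∘ₗ desc k fun z y => T y z)]
    congr 1
    refine hom_ext fun z y a => ?_
    simp only [LinearMap.comp_apply, desc_incl, hD]
    rfl
  have h2 : D ∘ₗ (desc k fun z y => T y z) = (Coalgebra.counit : _ →ₗ[k] k).smulRight (D v) +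
      TensorProduct.lift (desc k fun z y => LinearMap.compRight k D ∘ₗ F z ∘ₗ T y z).flip ∘ₗ
        Coalgebra.comul := by
    refine hom_ext fun x y a => ?_
    rw [LinearMap.comp_apply, desc_incl, hT, LinearMap.add_apply, LinearMap.add_apply, map_add,
      LinearMap.comp_apply _ Coalgebra.comul, lift_comul_incl, LinearMap.sum_apply, map_sum]
    congr 1
    · simp only [LinearMap.comp_apply, LinearMap.smulRight_apply, map_smul]
      rfl
    · refine Finset.sum_congr rfl fun z _ => ?_
      rw [LinearMap.comp_apply, ← LinearMap.comp_apply D]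
      congr 1
      refine TensorProduct.ext' fun u b => ?_
      simp
  rw [h1, h2, map_add, Q.contraunit, eq_comm, add_eq_right] at h
  exact h

end LeftContramodule

/-! ### Dualizing the factorization through a finite set of objects -/

namespace CatCoalgebra

variable {k : Type u} [Field k] {E : Type v} [Category.{w} E] [Preadditive E]
  [CategoryTheory.Linear k E]

/-- For `z ≺ y`, the elements of `Hom(z, y)^*` are determined by finitely many components of their
comultiplications. -/
lemma exists_leftInverse_comulComp [LocallyFiniteCat k E] {y : E}
    (X : Finset E)
    (hX : ∀ (z : E) (f : z ⟶ y), HomLT z y →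
      ∃ (n : ℕ) (x : Fin n → E) (g : ∀ i, z ⟶ x i) (h : ∀ i, x i ⟶ y),
        (∀ i, x i ∈ X) ∧ f = ∑ i, g i ≫ h i) (z : E) :
    ∃ ρ : (∀ x : X, Module.Dual k (z ⟶ (x : E)) ⊗[k] Module.Dual k ((x : E) ⟶ y)) →ₗ[k]
        Module.Dual k (z ⟶ y),
      (HomLT z y → ∀ a, ρ (fun x => comulComp k z x y a) = a) ∧ (¬ HomLT z y → ρ = 0) := by
  by_cases hz : HomLT z y
  -- Composition through `X` spans `Hom(z, y)`, so the dual map is injective, and over a field it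
  -- splits.
  · obtain ⟨ρ, hρ⟩ := LinearMap.exists_leftInverse_of_injective (K := k) (V := Module.Dual k (z ⟶ y))
      (V' := ∀ x : X, Module.Dual k (z ⟶ (x : E)) ⊗[k] Module.Dual k ((x : E) ⟶ y))
      (LinearMap.pi fun x : X => comulComp k z (x : E) y) <| by
        rw [LinearMap.ker_eq_bot']
        refine fun a ha => LinearMap.ext fun f => ?_
        obtain ⟨n, x, g, h, hx, rfl⟩ := hX z f hz
        rw [map_sum]
        refine Finset.sum_eq_zero fun i _ => ?_
        rw [← dualDistrib_comulComp]
        have := congr_fun ha ⟨x i, hx i⟩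
        simp only [LinearMap.pi_apply, Pi.zero_apply] at this
        rw [this]
        simp
    exact ⟨ρ, fun _ a => LinearMap.congr_fun hρ a, fun h => (h hz).elim⟩
  · exact ⟨0, fun h => (hz h).elim, fun _ => rfl⟩

/-- The part of a linear map supported on the summands `Hom(z, y)^*` with `z ≺ y`. -/
noncomputable def below {M : Type*} [AddCommGroup M] [Module k M] (y : E)
    (g : CatCoalgebra k E →ₗ[k] M) : CatCoalgebra k E →ₗ[k] M :=
  open Classical in desc k fun z w => if w = y ∧ HomLT z y then g ∘ₗ incl k z w else 0

-- The splittings `ρ z` reconstruct the summands with `z ≺ y` from their comultiplication components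
-- through `X`. They are chosen separately for each `z`, as no compatibility between them is
-- required.
open Classical in
lemma exists_lift_comul_eq_below [LeftStrictlyLocallyFiniteCat k E] (y : E) :
    ∃ (X : Finset E) (F : CatCoalgebra k E →ₗ[k] CatCoalgebra k E →ₗ[k] CatCoalgebra k E),
      (∀ x ∈ X, HomLT x y) ∧
      (∀ x w a, ¬ (x ∈ X ∧ w = y) → F (incl k x w a) = 0) ∧
      TensorProduct.lift F.flip ∘ₗ Coalgebra.comul = below y LinearMap.id := by
  obtain ⟨X, hXlt, hX⟩ := LeftStrictlyLocallyFiniteCat.exists_finset (k := k) y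
  choose ρ hρ hρ0 using exists_leftInverse_comulComp (k := k) X hX
  let G (z x : E) : Module.Dual k (z ⟶ x) →ₗ[k] Module.Dual k (x ⟶ y) →ₗ[k]
      CatCoalgebra k E :=
    if hx : x ∈ X then
      TensorProduct.curry (incl k z y ∘ₗ ρ z ∘ₗ LinearMap.single k (fun x : X =>
        Module.Dual k (z ⟶ (x : E)) ⊗[k] Module.Dual k ((x : E) ⟶ y)) ⟨x, hx⟩)
    else 0
  let H : CatCoalgebra k E →ₗ[k] CatCoalgebra k E →ₗ[k] CatCoalgebra k E :=
    desc k fun z x => LinearMap.lcomp k _ (proj k x y) ∘ₗ G z x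
  have hH (z x x' w : E) (u : Module.Dual k (z ⟶ x)) (a : Module.Dual k (x' ⟶ w)) :
      H (incl k z x u) (incl k x' w a) = G z x u (proj k x y (incl k x' w a)) := by
    simp [H]
  refine ⟨X, H.flip, hXlt, fun x w a h => hom_ext fun z x' u => ?_, hom_ext fun z w a => ?_⟩
  · rw [LinearMap.flip_apply, hH, LinearMap.zero_apply]
    by_cases hx : x' ∈ X
    · rw [proj_incl_ne, map_zero]
      rintro h'
      obtain ⟨rfl, rfl⟩ := Prod.mk.inj h'
      exact h ⟨hx, rfl⟩
    · simp [G, hx]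
  · rw [LinearMap.flip_flip, LinearMap.comp_apply, lift_comul_incl, below, desc_incl]
    by_cases hw : w = y
    · subst hw
      have h1 (x : E) : TensorProduct.lift (H.compl₁₂ (incl k z x) (incl k x w)) =
          TensorProduct.lift (G z x) := by
        refine TensorProduct.ext' fun u b => ?_
        simp [hH]
      -- Both sums equal the sum over the union: the comultiplication component vanishes off the
      -- interval, and `G` vanishes off `X`.
      have h2 : ∑ x ∈ (LocallyFiniteCat.finite_interval k z w).toFinset,
          TensorProduct.lift (G z x) (comulComp k z x w a) =
          ∑ x ∈ X, TensorProduct.lift (G z x) (comulComp k z x w a) := by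
        refine (Finset.sum_subset Finset.subset_union_left fun x _ hx => ?_).trans
          (Finset.sum_subset (Finset.subset_union_right
            (s₁ := (LocallyFiniteCat.finite_interval k z w).toFinset)) fun x _ hx => ?_).symm
        · rw [comulComp_eq_zero hx, map_zero]
        · simp only [G, dif_neg hx]
          exact LinearMap.congr_fun (f := TensorProduct.lift 0) (g := 0)
            (TensorProduct.ext' fun _ _ => rfl) _
      have h3 : ∑ x ∈ X, TensorProduct.lift (G z x) (comulComp k z x w a) =
          incl k z w (ρ z fun x => comulComp k z x w a) := by
        rw [← Finset.sum_attach, ← Finset.univ_eq_attach,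
          ← Finset.univ_sum_single (fun x : X => comulComp k z (x : E) w a), map_sum, map_sum]
        refine Finset.sum_congr rfl fun x _ => ?_
        simp only [G, x.2, dif_pos]
        rw [show ∀ f, TensorProduct.lift (TensorProduct.curry f) = f from
          fun f => TensorProduct.ext' fun _ _ => rfl]
        rfl
      simp only [h1, h2, h3]
      by_cases hz : HomLT z w
      · simp [hz, hρ z hz]
      · simp [hz, hρ0 z hz]
    · rw [if_neg fun h => hw h.1]
      refine Finset.sum_eq_zero fun x _ => ?_
      have : TensorProduct.lift (H.compl₁₂ (incl k z x) (incl k x w)) = 0 := by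
        refine TensorProduct.ext' fun u b => ?_
        simp [hH, proj_incl_ne x w x y (by simp [hw])]
      rw [this, LinearMap.zero_apply]

end CatCoalgebra

/-! ### Vanishing of the defect -/

namespace LeftContramodule

open CatCoalgebra

variable {k : Type u} [Field k] {E : Type v} [Category.{w} E] [Preadditive E]
  [CategoryTheory.Linear k E]

/-- The failure of a linear map to commute with the contraactions. -/
noncomputable def defect [LocallyFiniteCat k E] {P Q : LeftContramodule.{t} k (CatCoalgebra k E)}
    (φ : P.carrier →ₗ[k] Q.carrier) : (CatCoalgebra k E →ₗ[k] P.carrier) →ₗ[k] Q.carrier :=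
  φ ∘ₗ P.π - Q.π ∘ₗ LinearMap.compRight k φ

lemma defect_apply [LocallyFiniteCat k E] {P Q : LeftContramodule.{t} k (CatCoalgebra k E)}
    (φ : P.carrier →ₗ[k] Q.carrier) (g : CatCoalgebra k E →ₗ[k] P.carrier) :
    defect φ g = φ (P.π g) - Q.π (φ ∘ₗ g) := rfl

/-- Expanding in a basis of `Hom(x, y)` turns the contraaction into a finite sum of actions of
morphisms, which `φ` respects. -/
lemma defect_comp_proj [LocallyFiniteCat k E] {P Q : LeftContramodule.{t} k (CatCoalgebra k E)}
    (φ : P.carrier →ₗ[k] Q.carrier)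
    (hφ : ∀ (x y : E) (f : x ⟶ y) p, φ (P.act (ev k f) p) = Q.act (ev k f) (φ p))
    {x y : E} (η : Module.Dual k (x ⟶ y) →ₗ[k] P.carrier) : defect φ (η ∘ₗ proj k x y) = 0 := by
  let b := Module.finBasis k (x ⟶ y)
  have h : η ∘ₗ proj k x y = ∑ i, (ev k (b i)).smulRight (η (b.coord i)) := by
    ext c
    simp only [LinearMap.comp_apply, LinearMap.sum_apply, LinearMap.smulRight_apply]
    conv_lhs => rw [← b.sum_dual_apply_smul_coord (proj k x y c), map_sum]
    exact Finset.sum_congr rfl fun i _ => map_smul _ _ _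
  rw [h, map_sum]
  refine Finset.sum_eq_zero fun i _ => ?_
  rw [defect_apply, ← act_apply, hφ, act_apply, sub_eq_zero]
  congr 1
  ext c
  simp

lemma defect_eq_zero_of_finite [LocallyFiniteCat k E]
    {P Q : LeftContramodule.{t} k (CatCoalgebra k E)} (φ : P.carrier →ₗ[k] Q.carrier)
    (hφ : ∀ (x y : E) (f : x ⟶ y) p, φ (P.act (ev k f) p) = Q.act (ev k f) (φ p))
    (y : E) (X : Finset E) (g : CatCoalgebra k E →ₗ[k] P.carrier)
    (hg : ∀ x w a, ¬ (x ∈ X ∧ w = y) → g (incl k x w a) = 0) : defect φ g = 0 := by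
  have h : g = ∑ x ∈ X, (g ∘ₗ incl k x y) ∘ₗ proj k x y := by
    refine hom_ext fun x w a => ?_
    simp only [LinearMap.sum_apply, LinearMap.comp_apply]
    by_cases hxw : x ∈ X ∧ w = y
    · obtain ⟨hx, rfl⟩ := hxw
      rw [Finset.sum_eq_single_of_mem x hx, proj_incl_self]
      intro z _ hz
      rw [proj_incl_ne _ _ _ _ (by simp [hz.symm]), map_zero, map_zero]
    · rw [hg _ _ _ hxw]
      refine (Finset.sum_eq_zero fun z hz => ?_).symm
      rw [proj_incl_ne, map_zero, map_zero]
      intro h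
      obtain ⟨rfl, rfl⟩ := Prod.mk.inj h
      exact hxw ⟨hz, rfl⟩
  rw [h, map_sum]
  exact Finset.sum_eq_zero fun x _ => defect_comp_proj φ hφ _

lemma act_ev_id_defect [LocallyFiniteCat k E]
    {P Q : LeftContramodule.{t} k (CatCoalgebra k E)} (φ : P.carrier →ₗ[k] Q.carrier)
    (hφ : ∀ (x y : E) (f : x ⟶ y) p, φ (P.act (ev k f) p) = Q.act (ev k f) (φ p))
    (y : E) (g : CatCoalgebra k E →ₗ[k] P.carrier) :
    Q.act (ev k (𝟙 y)) (defect φ g) = defect φ (g ∘ₗ below y LinearMap.id) := by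
  classical
  rw [defect_apply, map_sub, ← hφ, act_ev_id_π, act_ev_id_π]
  have h1 : (desc k fun x w => if w = y then (φ ∘ₗ g) ∘ₗ incl k x w else 0) =
      φ ∘ₗ desc k fun x w => if w = y then g ∘ₗ incl k x w else 0 := by
    refine hom_ext fun x w a => ?_
    rw [LinearMap.comp_apply, desc_incl, desc_incl]
    split_ifs <;> simp
  rw [h1, ← defect_apply, ← sub_eq_zero, ← map_sub]
  -- The discarded summands have `Hom(x, y) ≠ 0` without `x ≺ y`, so `x ⪯ y ⪯ x`, leaving finitely
  -- many `x`.
  refine defect_eq_zero_of_finite φ hφ y (LocallyFiniteCat.finite_interval k y y).toFinset _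
    fun x w a h => ?_
  rw [mem_interval (k := k)] at h
  by_cases hw : w = y
  · subst hw
    by_cases hx : HomLT x w
    · simp [below, hx]
    · suffices a = 0 by simp [this]
      ext f
      by_contra hf
      have hxw : HomLE x w := homLE_of_ne_zero (f := f) fun h => hf (by simp [h])
      exact h ⟨⟨not_not.1 fun h' => hx ⟨hxw, h'⟩, hxw⟩, rfl⟩
  · simp [below, hw]

lemma defect_eq_zero [LeftStrictlyLocallyFiniteCat k E]
    {P Q : LeftContramodule.{t} k (CatCoalgebra k E)} (φ : P.carrier →ₗ[k] Q.carrier)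
    (hφ : ∀ (x y : E) (f : x ⟶ y) p, φ (P.act (ev k f) p) = Q.act (ev k f) (φ p)) :
    defect φ = 0 := by
  choose X F hX hF0 hF using exists_lift_comul_eq_below (k := k) (E := E)
  have hcomp (R : LeftContramodule.{t} k (CatCoalgebra k E)) (y : E)
      (g : CatCoalgebra k E →ₗ[k] R.carrier) :
      R.π (g ∘ₗ below y LinearMap.id) = R.π (R.π ∘ₗ LinearMap.compRight k g ∘ₗ F y) := by
    rw [← R.contraassoc, ← hF, ← LinearMap.comp_assoc]
    congr 2
    exact TensorProduct.ext' fun u v => by simp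
  -- Nakayama is applied with `V` the space of all maps `g`, and with `g` sent to the family `c ↦ g
  -- ∘ₗ F y c`.
  refine Q.eq_zero_of_act_ev_id_eq_π _
    (fun y => LinearMap.lcomp k _ (F y) ∘ₗ LinearMap.llcomp k _ _ _) (fun y g => ?_)
    fun x y g a hxy => ?_
  · rw [act_ev_id_defect φ hφ, defect_apply, hcomp, ← LinearMap.comp_assoc _ g φ, hcomp]
    -- The outer contraaction is finite, so `φ` passes through it; the difference left is that of
    -- the inner contraactions, again a defect.
    have h := defect_eq_zero_of_finite φ hφ y (X y)
      (P.π ∘ₗ LinearMap.compRight k g ∘ₗ F y) fun x w a h => by simp [hF0 y x w a h]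
    rw [defect_apply, sub_eq_zero] at h
    rw [h, ← map_sub]
    rfl
  · have := hF0 y x y a fun h => hxy (hX y x h.1)
    simp [this]

end LeftContramodule

/-! ### Full faithfulness -/

theorem mainTheorem1 (k : Type u) [Field k] (E : Type v) [Category.{w} E] [Preadditive E]
    [CategoryTheory.Linear k E] [LeftStrictlyLocallyFiniteCat k E] :
    (contraForget.{t} k E).Full ∧ (contraForget.{t} k E).Faithful := by
  open CatCoalgebra ContraForget in
  refine ⟨⟨fun {P Q} α => ?_⟩, ⟨fun {P Q} φ φ' h => ?_⟩⟩
  · let ψ (x : E) : P.carrier →ₗ[k] Q.carrier := (component Q x).subtype ∘ₗ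
      (α.hom.app x).hom ∘ₗ (P.act (ev k (𝟙 x))).rangeRestrict
    have hψ {x y : E} (f : x ⟶ y) (p : P.carrier) :
        Q.act (ev k f) (ψ x p) = ψ y (P.act (ev k f) p) := by
      have h := congr_arg Subtype.val (LinearMap.congr_fun (congr_arg ModuleCat.Hom.hom
        (α.hom.naturality f)) ((P.act (ev k (𝟙 x))).rangeRestrict p))
      refine (h.symm.trans ?_ :)
      refine congr_arg (fun q => ((α.hom.app y).hom q : component Q y).1) (Subtype.ext ?_)
      change P.act (ev k f) (P.act (ev k (𝟙 x)) p) = P.act (ev k (𝟙 y)) (P.act (ev k f) p)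
      rw [act_ev_act_ev, act_ev_act_ev, Category.id_comp, Category.comp_id]
    -- A pointwise choice suffices: an element is determined by its components, so linearity of `φ`
    -- follows from that of each `ψ x`.
    choose φ hφ using fun p => Q.exists_act_ev_id_eq fun x => ψ x p
    have hφ' (x : E) (p : P.carrier) : Q.act (ev k (𝟙 x)) (φ p) = ψ x p := by
      rw [hφ]
      exact act_id Q _ (Subtype.property _)
    let Φ : P.carrier →ₗ[k] Q.carrier :=
      { toFun := φ
        map_add' := fun p q => Q.ext_act_ev_id fun x => by simp only [map_add, hφ']
        map_smul' := fun r p => Q.ext_act_ev_id fun x => by simp only [map_smul, hφ', RingHom.id_apply] }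
    have hΦ (x y : E) (f : x ⟶ y) (p : P.carrier) :
        Φ (P.act (ev k f) p) = Q.act (ev k f) (Φ p) := by
      refine Q.ext_act_ev_id fun z => ?_
      change Q.act (ev k (𝟙 z)) (φ (P.act (ev k f) p)) = Q.act (ev k (𝟙 z)) (Q.act (ev k f) (φ p))
      rw [hφ']
      by_cases hz : z = y
      · subst hz
        rw [← hψ, ← hφ', act_ev_act_ev, act_ev_act_ev, Category.id_comp, Category.comp_id]
      · have h0 : (P.act (ev k (𝟙 z))).rangeRestrict (P.act (ev k f) p) = 0 :=
          Subtype.ext (P.act_ev_id_act_ev_of_ne hz f p)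
        rw [Q.act_ev_id_act_ev_of_ne hz]
        exact (congr_arg (fun q => ((α.hom.app z).hom q : component Q z).1) h0).trans
          (congr_arg Subtype.val (map_zero (α.hom.app z).hom))
    refine ⟨⟨Φ, fun g => sub_eq_zero.1
      (LinearMap.congr_fun (LeftContramodule.defect_eq_zero Φ hΦ) g)⟩, ?_⟩
    refine ObjectProperty.hom_ext _ (NatTrans.ext (funext fun x => ModuleCat.hom_ext
      (LinearMap.ext fun p => Subtype.ext ?_)))
    change Φ p.1 = _
    rw [← act_id P p.1 p.2, hΦ]
    refine (hφ' x p.1).trans (congr_arg (fun q => ((α.hom.app x).hom q : component Q x).1) ?_)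
    exact Subtype.ext (act_id P p.1 p.2)
  · refine LeftContramodule.Hom.ext (LinearMap.ext fun p => Q.ext_act_ev_id fun x => ?_)
    rw [← LeftContramodule.Hom.map_act, ← LeftContramodule.Hom.map_act]
    exact congr_arg (fun β => ((β.hom.app x).hom
      ((P.act (ev k (𝟙 x))).rangeRestrict p) : component Q x).1) h
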